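/- For a metric space $(X,d)$ and $p\in[1,\infty)$, let $M_p(X)\in[0,\infty]$ denote the Markov type $p$ constant of $X$: the infimum of all $K>0$ such that for every $n$, every stationary reversible Markov chain $\{Z_t\}_{t\ge 0}$ on $\{1,\dots,n\}$ (that is, with transition probabilities $a_{ij}$ and $\pi_i=\Pr(Z_t=i)$ independent of $t$, satisfying $\pi_i a_{ij}=\pi_j a_{ji}$ for all $i,j$), every map $f:\{1,\dots,n\}\to X$ and every $t\in\mathbb N$, $$\mathbb E\, d(f(Z_t),f(Z_0))^p\le K^p\, t\;\mathbb E\, d(f(Z_1),f(Z_0))^p ,$$ with $M_p(X)=\infty$ if there is no such $K$. Let $\Gamma_3$ be the infinite $3$-regular tree, regarded as the metric space formed by its vertices with the graph distance. Then $$M_2(\Gamma_3)\ge\sqrt 3 .$$ -/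

import Mathlib

open MeasureTheory
open scoped ENNReal

/-- The process `Z 0, Z 1, …` on the probability space `(Ω, P)` is a stationary reversible Markov
chain on the state space `Fin n`, with transition probabilities `a` and stationary
distribution `π`. -/
structure IsStationaryReversibleMarkovChain {n : ℕ} {Ω : Type*} [MeasurableSpace Ω]
    (P : Measure Ω) (π : Fin n → ℝ) (a : Matrix (Fin n) (Fin n) ℝ) (Z : ℕ → Ω → Fin n) :
    Prop where
  /-- Each `Z t` is a random variable. -/
  measurable : ∀ t, Measurable (Z t)
  /-- `a` is a matrix of transition probabilities: its entries are nonnegative and its rows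
  sum to one. -/
  stochastic : a ∈ Matrix.rowStochastic ℝ (Fin n)
  /-- The Markov property: given `Z 0 = x 0, …, Z t = x t`, the probability of
  `Z (t + 1) = x (t + 1)` is `a (x t) (x (t + 1))` (with the denominator of the conditional
  probability cleared). -/
  markov : ∀ (t : ℕ) (x : ℕ → Fin n),
    P.real {ω | ∀ s ≤ t + 1, Z s ω = x s} =
      P.real {ω | ∀ s ≤ t, Z s ω = x s} * a (x t) (x (t + 1))
  /-- Stationarity: every `Z t` has law `π`. -/
  stationary : ∀ (t : ℕ) (i : Fin n), P.real {ω | Z t ω = i} = π i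
  /-- Reversibility (detailed balance). -/
  reversible : ∀ i j : Fin n, π i * a i j = π j * a j i

/-- The metric space `X` satisfies the Markov type `p` inequality with constant `K`: for every
finite stationary reversible Markov chain `Z`, every map `f` from the state space to `X` and every
time `t`, one has `𝔼 d(f(Z_t), f(Z_0))^p ≤ K^p t 𝔼 d(f(Z_1), f(Z_0))^p`. -/
def MarkovTypeInequality (X : Type*) [MetricSpace X] (p K : ℝ) : Prop :=
  ∀ (n : ℕ) (Ω : Type) [MeasurableSpace Ω] (P : Measure Ω) [IsProbabilityMeasure P]
    (π : Fin n → ℝ) (a : Matrix (Fin n) (Fin n) ℝ) (Z : ℕ → Ω → Fin n),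
    IsStationaryReversibleMarkovChain P π a Z →
    ∀ (f : Fin n → X) (t : ℕ),
      ∫ ω, dist (f (Z t ω)) (f (Z 0 ω)) ^ p ∂P ≤
        K ^ p * t * ∫ ω, dist (f (Z 1 ω)) (f (Z 0 ω)) ^ p ∂P

/-- The Markov type `p` constant `M_p(X)`: the infimum of all `K > 0` for which the Markov type `p`
inequality holds; it is `∞` exactly when `X` does not have Markov type `p`. -/
noncomputable def markovTypeConstant (X : Type*) [MetricSpace X] (p : ℝ) : ℝ≥0∞ :=
  ⨅ (K : ℝ) (_ : 0 < K) (_ : MarkovTypeInequality X p K), ENNReal.ofReal K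

/-- The vertex set of a connected graph, as a metric space with the graph distance. -/
noncomputable abbrev graphMetricSpace {V : Type*} (G : SimpleGraph V) (hG : G.Connected) :
    MetricSpace V where
  dist u v := (G.dist u v : ℝ)
  dist_self u := by simp
  dist_comm u v := by rw [SimpleGraph.dist_comm]
  dist_triangle u v w := by exact_mod_cast hG.dist_triangle
  eq_of_dist_eq_zero h := hG.dist_eq_zero_iff.1 (by exact_mod_cast h)

/-! The extremal chains are walks on words over `b` letters, that is, on a rooted `b`-ary tree,
which append a random letter or drop the last one with probability 1/2 each. Away from the ends the
length is an unbiased walk S. For large `b` an appended letter rarely leads back towards the start,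
so the longest common prefix of start and current word has length about min S, and their distance is
about S_0 + S_t - 2 min S. By Pitman's theorem this behaves like a three-dimensional Bessel process:
its second moment is about 3t, while single steps have length at most 1.

An exact computation replaces Pitman's theorem. Let k and l be the distances of the start and of the
current word from their branch point. `driftPoly` equals (k + l)² + 2(l² - k²) + 4k, and its drift
is 3 up to 4/b and effects of the ends (`drift_ge`). Reversibility exchanges k and l, so l² - k² has
mean zero, and 4k is of lower order (`pairMean_wordDist_sq_ge`).

Degree 3 suffices because replacing letters by binary blocks of length `D`, much larger than `b`,
embeds the `b`-ary tree with distortion tending to 1 after scaling. -/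

/-! ### Finite chains and the matrix form of the Markov type inequality -/

open ProbabilityTheory Preorder in
/-- A finite Markov chain with given initial law and transition matrix exists, with the expected
two-dimensional marginals. -/
theorem exists_stationaryReversibleMarkovChain {n : ℕ} {π : Fin n → ℝ}
    {a : Matrix (Fin n) (Fin n) ℝ} (hπ0 : ∀ i, 0 ≤ π i) (hπ1 : ∑ i, π i = 1)
    (ha : a ∈ Matrix.rowStochastic ℝ (Fin n)) (hrev : ∀ i j, π i * a i j = π j * a j i) :
    ∃ (Ω : Type) (_ : MeasurableSpace Ω) (P : Measure Ω) (_ : IsProbabilityMeasure P)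
      (Z : ℕ → Ω → Fin n), IsStationaryReversibleMarkovChain P π a Z ∧
        ∀ t i j, P.real {ω | Z 0 ω = i ∧ Z t ω = j} = π i * (a ^ t) i j := by
  classical
  have ha0 : ∀ i j, 0 ≤ a i j := fun i j => Matrix.nonneg_of_mem_rowStochastic ha
  have ha1 : ∀ i, ∑ j, a i j = 1 := Matrix.sum_row_of_mem_rowStochastic ha
  let law : (q : Fin n → ℝ) → Measure (Fin n) :=
    fun q => ∑ j, ENNReal.ofReal (q j) • Measure.dirac j
  have law_apply : ∀ q : Fin n → ℝ, ∀ j, law q {j} = ENNReal.ofReal (q j) := by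
    intro q j
    simp [law, Measure.finsetSum_apply, Set.indicator_apply]
  have law_prob : ∀ q : Fin n → ℝ, (∀ j, 0 ≤ q j) → ∑ j, q j = 1 →
      IsProbabilityMeasure (law q) := by
    intro q h0 h1
    constructor
    simp [law, Measure.finsetSum_apply, ← ENNReal.ofReal_sum_of_nonneg (fun j _ => h0 j), h1]
  have : IsProbabilityMeasure (law π) := law_prob π hπ0 hπ1
  let M : Kernel (Fin n) (Fin n) := Kernel.ofFunOfCountable fun i => law (a i)
  have hM : IsMarkovKernel M := ⟨fun i => law_prob (a i) (ha0 i) (ha1 i)⟩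
  let κ : (t : ℕ) → Kernel (Π _ : Finset.Iic t, Fin n) (Fin n) := fun t =>
    M.comap (fun u => u ⟨t, by simp⟩) (by fun_prop)
  have hκ : ∀ t, IsMarkovKernel (κ t) := fun t => by dsimp only [κ]; infer_instance
  -- Ionescu-Tulcea measure on trajectories, with kernels that look only at the last coordinate.
  let P : Measure (ℕ → Fin n) := Kernel.trajMeasure (X := fun _ => Fin n) (law π) κ
  have hP : IsProbabilityMeasure P := by dsimp only [P]; infer_instance
  -- Allowing an arbitrary event `B` of the history lets one identity yield the joint law with time
  -- 0, the Markov property and stationarity.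
  have step : ∀ (t : ℕ) (B : Set (Π _ : Finset.Iic t, Fin n)), MeasurableSet B → ∀ j,
      P.real {x | frestrictLe (π := fun _ => Fin n) t x ∈ B ∧ x (t + 1) = j} =
        ∑ k, P.real {x | frestrictLe (π := fun _ => Fin n) t x ∈ B ∧ x t = k} * a k j := by
    intro t B hB j
    have hE : MeasurableSet {x : ℕ → Fin n | frestrictLe (π := fun _ => Fin n) t x ∈ B} :=
      measurable_frestrictLe t hB
    have hfin : P {x | frestrictLe (π := fun _ => Fin n) t x ∈ B ∧ x (t + 1) = j} =
        ∑ k, ENNReal.ofReal (a k j) *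
          P {x | frestrictLe (π := fun _ => Fin n) t x ∈ B ∧ x t = k} := by
      calc _ = (P.map (fun x => (frestrictLe (π := fun _ => Fin n) t x, x (t + 1))))
              (B ×ˢ {j}) := by
            rw [Measure.map_apply (by fun_prop) (hB.prod (measurableSet_singleton j))]
            rfl
        _ = ∫⁻ u in B, κ t u {j} ∂(P.map (frestrictLe (π := fun _ => Fin n) t)) := by
            rw [← Kernel.map_frestrictLe_trajMeasure_compProd_eq_map_trajMeasure,
              Measure.compProd_apply_prod hB (measurableSet_singleton j)]
        _ = ∫⁻ x in {x | frestrictLe (π := fun _ => Fin n) t x ∈ B},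
              ENNReal.ofReal (a (x t) j) ∂P := by
            rw [setLIntegral_map hB (Kernel.measurable_coe _ (measurableSet_singleton j))
              (measurable_frestrictLe t)]
            exact lintegral_congr fun x => law_apply _ j
        _ = ∫⁻ k, ENNReal.ofReal (a k j)
              ∂((P.restrict {x | frestrictLe (π := fun _ => Fin n) t x ∈ B}).map
                fun x => x t) := by
            rw [lintegral_map (measurable_of_finite _) (measurable_pi_apply t)]
        _ = _ := by
            rw [lintegral_fintype]
            refine Finset.sum_congr rfl fun k _ => ?_
            rw [Measure.map_apply (measurable_pi_apply t) (measurableSet_singleton k),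
              Measure.restrict_apply (measurable_pi_apply t (measurableSet_singleton k))]
            congr 2
            ext x
            exact and_comm
    rw [measureReal_def, hfin, ENNReal.toReal_sum fun k _ => by finiteness]
    refine Finset.sum_congr rfl fun k _ => ?_
    rw [ENNReal.toReal_mul, ENNReal.toReal_ofReal (ha0 k j), mul_comm, measureReal_def]
  have init : ∀ i, P.real {x | x 0 = i} = π i := by
    intro i
    have hs : MeasurableSet {u : Π _ : Finset.Iic 0, Fin n | u ⟨0, by simp⟩ = i} :=
      (Set.toFinite _).measurableSet
    have hpre : {x : ℕ → Fin n | x 0 = i} =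
        frestrictLe (π := fun _ => Fin n) 0 ⁻¹' {u | u ⟨0, by simp⟩ = i} := rfl
    have hP0 : P {x | x 0 = i} = law π {i} := by
      dsimp only [P, Kernel.trajMeasure]
      rw [hpre, ← Measure.map_apply (measurable_frestrictLe 0) hs,
        Measure.map_comp _ _ (measurable_frestrictLe 0), Kernel.traj_map_frestrictLe,
        Kernel.partialTraj_self, Measure.id_comp,
        Measure.map_apply (MeasurableEquiv.measurable _) hs]
      rfl
    rw [measureReal_def, hP0, law_apply, ENNReal.toReal_ofReal (hπ0 i)]
  have joint : ∀ t i j, P.real {x | x 0 = i ∧ x t = j} = π i * (a ^ t) i j := by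
    intro t
    induction t with
    | zero =>
      intro i j
      by_cases hij : i = j
      · subst hij
        simp [init]
      · have : {x : ℕ → Fin n | x 0 = i ∧ x 0 = j} = ∅ := by
          ext x
          simp only [Set.mem_ofPred_eq, Set.mem_empty_iff_false, iff_false, not_and]
          exact fun h h' => hij (h.symm.trans h')
        simp [this, hij]
    | succ t ih =>
      intro i j
      have := step t {u | u ⟨0, by simp⟩ = i}
        (Set.toFinite _).measurableSet j
      simp only [Set.mem_ofPred_eq, frestrictLe_apply, ih] at this
      rw [this, pow_succ, Matrix.mul_apply, Finset.mul_sum]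
      exact Finset.sum_congr rfl fun k _ => by ring
  refine ⟨ℕ → Fin n, inferInstance, P, hP, fun t x => x t, ⟨?_, ha, ?_, ?_, hrev⟩, joint⟩
  · intro t; fun_prop
  · intro t x
    have := step t {frestrictLe (π := fun _ => Fin n) t x} (measurableSet_singleton _) (x (t + 1))
    have hfr : ∀ y : ℕ → Fin n, frestrictLe (π := fun _ => Fin n) t y ∈
        ({frestrictLe (π := fun _ => Fin n) t x} : Set _) ↔ ∀ s ≤ t, y s = x s := by
      intro y
      simp [funext_iff]
    simp only [hfr] at this
    rw [Finset.sum_eq_single (x t)] at this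
    · convert this using 3
      · ext y
        simp only [Nat.le_succ_iff, or_imp, forall_and, forall_eq]
      · ext y
        exact ⟨fun h => ⟨h, h t le_rfl⟩, fun h => h.1⟩
    · intro k _ hk
      have : {y : ℕ → Fin n | (∀ s ≤ t, y s = x s) ∧ y t = k} = ∅ := by
        ext y
        simp only [Set.mem_ofPred_eq, Set.mem_empty_iff_false, iff_false, not_and]
        exact fun h h' => hk (h'.symm.trans (h t le_rfl))
      simp [this]
    · simp
  · intro t
    induction t with
    | zero => exact init
    | succ t ih =>
      intro j
      have := step t Set.univ MeasurableSet.univ j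
      simp only [Set.mem_univ, true_and, ih] at this
      rw [this, Finset.sum_congr rfl fun k _ => hrev k j, ← Finset.mul_sum, ha1, mul_one]

/-- Both integrals depend only on the joint law of `Z 0` and `Z t`, given by powers of `a`; this
eliminates probability spaces from the rest of the argument. -/
theorem MarkovTypeInequality.sum_fin_le {X : Type*} [MetricSpace X] {p K : ℝ}
    (h : MarkovTypeInequality X p K) {n : ℕ} {π : Fin n → ℝ}
    {a : Matrix (Fin n) (Fin n) ℝ} (hπ0 : ∀ i, 0 ≤ π i) (hπ1 : ∑ i, π i = 1)
    (ha : a ∈ Matrix.rowStochastic ℝ (Fin n)) (hrev : ∀ i j, π i * a i j = π j * a j i)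
    (f : Fin n → X) (t : ℕ) :
    ∑ i, ∑ j, π i * (a ^ t) i j * dist (f j) (f i) ^ p ≤
      K ^ p * t * ∑ i, ∑ j, π i * a i j * dist (f j) (f i) ^ p := by
  obtain ⟨Ω, mΩ, P, hP, Z, hZ, hj⟩ := exists_stationaryReversibleMarkovChain hπ0 hπ1 ha hrev
  have key : ∀ s, ∫ ω, dist (f (Z s ω)) (f (Z 0 ω)) ^ p ∂P =
      ∑ i, ∑ j, π i * (a ^ s) i j * dist (f j) (f i) ^ p := by
    intro s
    have hm : Measurable fun ω => (Z 0 ω, Z s ω) := (hZ.measurable 0).prodMk (hZ.measurable s)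
    have := integral_map (μ := P) hm.aemeasurable
      (f := fun z : Fin n × Fin n => dist (f z.2) (f z.1) ^ p)
      (measurable_of_finite _).aestronglyMeasurable
    rw [← this, integral_fintype (Integrable.of_finite), Fintype.sum_prod_type]
    refine Finset.sum_congr rfl fun i _ => Finset.sum_congr rfl fun j _ => ?_
    rw [map_measureReal_apply hm (measurableSet_singleton _), ← hj s i j, smul_eq_mul]
    congr 2
    ext ω
    simp
  have := h n Ω P π a Z hZ f t
  rw [key, key, pow_one] at this
  exact this

/-- A Markov type inequality, tested on a reversible transition matrix on a finite set. -/
theorem MarkovTypeInequality.sum_le {X : Type*} [MetricSpace X] {p K : ℝ}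
    (h : MarkovTypeInequality X p K) {S : Type*} [Fintype S] [DecidableEq S] {π : S → ℝ}
    {a : Matrix S S ℝ} (hπ0 : ∀ i, 0 ≤ π i) (hπ1 : ∑ i, π i = 1)
    (ha : a ∈ Matrix.rowStochastic ℝ S) (hrev : ∀ i j, π i * a i j = π j * a j i)
    (f : S → X) (t : ℕ) :
    ∑ i, ∑ j, π i * (a ^ t) i j * dist (f j) (f i) ^ p ≤
      K ^ p * t * ∑ i, ∑ j, π i * a i j * dist (f j) (f i) ^ p := by
  let e := Fintype.equivFin S
  have hpow : ∀ s, (Matrix.reindex e e a) ^ s = Matrix.reindex e e (a ^ s) := fun s =>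
    (map_pow (Matrix.reindexAlgEquiv ℝ ℝ e) a s).symm
  have := h.sum_fin_le (π := π ∘ e.symm) (a := Matrix.reindex e e a) (fun i => hπ0 _)
    (by rw [← hπ1]; exact e.symm.sum_comp π) (Matrix.reindex_mem_rowStochastic ha)
    (fun i j => hrev _ _) (f ∘ e.symm) t
  rw [hpow] at this
  have tr : ∀ b : Matrix S S ℝ, ∑ i, ∑ j, (π ∘ e.symm) i * Matrix.reindex e e b i j *
      dist ((f ∘ e.symm) j) ((f ∘ e.symm) i) ^ p =
      ∑ i, ∑ j, π i * b i j * dist (f j) (f i) ^ p := by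
    intro b
    rw [← e.symm.sum_comp]
    refine Finset.sum_congr rfl fun i _ => ?_
    rw [← e.symm.sum_comp]
    rfl
  rw [tr, tr] at this
  exact this

/-! ### Geodesics in trees -/

/-- In a tree, at most one neighbour of `v` is closer to `x` than `v`. -/
theorem SimpleGraph.IsTree.dist_eq_add_one_of_ne {V : Type*} {G : SimpleGraph V} (hG : G.IsTree)
    {x v a b : V} (ha : G.Adj v a) (hb : G.Adj v b) (hab : a ≠ b)
    (hxa : G.dist x v = G.dist x a + 1) : G.dist x b = G.dist x v + 1 := by
  refine (hG.dist_eq_dist_add_one_of_adj x hb).resolve_left fun hxb => hab ?_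
  -- If both neighbours were closer, geodesics through them would be two paths from `x` to `v`, with
  -- different penultimate vertices.
  obtain ⟨p, hp⟩ := hG.connected.exists_walk_length_eq_dist x a
  obtain ⟨q, hq⟩ := hG.connected.exists_walk_length_eq_dist x b
  have hp' : (p.concat ha.symm).IsPath :=
    SimpleGraph.Walk.isPath_of_length_eq_dist _ (by rw [SimpleGraph.Walk.length_concat]; omega)
  have hq' : (q.concat hb.symm).IsPath :=
    SimpleGraph.Walk.isPath_of_length_eq_dist _ (by rw [SimpleGraph.Walk.length_concat]; omega)
  have h := congrArg SimpleGraph.Walk.penultimate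
    (congrArg Subtype.val ((hG.isAcyclic.subsingleton_path x v).elim ⟨_, hp'⟩ ⟨_, hq'⟩))
  simpa using h

/-- The endpoint of the walk that starts at the second component of an oriented edge and follows
the instructions in a word, where `child p v c` is the neighbour to which the letter `c` leads
from the edge `(p, v)`. -/
def descend {V β : Type*} (child : V → V → β → V) : V → V → List β → V
  | _, v, [] => v
  | p, v, c :: w => descend child v (child p v c) w

/-! ### Common prefixes of words -/

/-- The length of the longest common prefix of two words. -/
def lcp {β : Type*} [DecidableEq β] : List β → List β → ℕ
  | a :: u, b :: v => if a = b then lcp u v + 1 else 0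
  | [], _ => 0
  | _ :: _, [] => 0

section lcp

variable {β : Type*} [DecidableEq β]

@[simp] theorem lcp_nil_left (v : List β) : lcp [] v = 0 := by simp [lcp]

@[simp] theorem lcp_nil_right (u : List β) : lcp u [] = 0 := by cases u <;> simp [lcp]

@[simp] theorem lcp_cons_cons (a b : β) (u v : List β) :
    lcp (a :: u) (b :: v) = if a = b then lcp u v + 1 else 0 := rfl

theorem lcp_comm (u v : List β) : lcp u v = lcp v u := by
  induction u generalizing v with
  | nil => simp
  | cons a u ih =>
    cases v with
    | nil => simp
    | cons b v => simp [ih, eq_comm]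

theorem lcp_le_left (u v : List β) : lcp u v ≤ u.length := by
  induction u generalizing v with
  | nil => simp
  | cons a u ih =>
    cases v with
    | nil => simp
    | cons b v =>
      have := ih v
      simp only [lcp_cons_cons, List.length_cons]
      split_ifs <;> omega

theorem lcp_le_right (u v : List β) : lcp u v ≤ v.length := lcp_comm u v ▸ lcp_le_left v u

@[simp] theorem lcp_self (u : List β) : lcp u u = u.length := by
  induction u with
  | nil => simp
  | cons a u ih => simp [ih]

theorem lcp_append_append (s u v : List β) : lcp (s ++ u) (s ++ v) = s.length + lcp u v := by
  induction s with
  | nil => simp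
  | cons a s ih => simp [ih]; omega

/-- The length of a common prefix drops to the new length when the last letter is dropped. -/
theorem lcp_dropLast (u v : List β) : lcp u v.dropLast = min (lcp u v) (v.length - 1) := by
  induction v generalizing u with
  | nil => simp
  | cons b v ih =>
    cases u with
    | nil => simp
    | cons a u =>
      cases v with
      | nil => simp
      | cons c v =>
        have := ih u
        simp only [List.dropLast_cons_cons, lcp_cons_cons, List.length_cons] at this ⊢
        split_ifs <;> omega

/-- Appending a letter to a word that is not a prefix does not change the common prefix. -/
theorem lcp_concat_of_lt {u v : List β} (h : lcp u v < v.length) (c : β) :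
    lcp u (v ++ [c]) = lcp u v := by
  induction v generalizing u with
  | nil => simp at h
  | cons b v ih =>
    cases u with
    | nil => simp
    | cons a u =>
      simp only [lcp_cons_cons, List.length_cons, List.cons_append] at h ⊢
      split_ifs at h ⊢
      · rw [ih (by omega)]
      · rfl

/-- If `v` is a prefix of `u`, then so is exactly one extension of `v` by a letter, unless
`u = v`. -/
theorem exists_lcp_concat_of_eq {u v : List β} (h : lcp u v = v.length)
    (hu : v.length < u.length) :
    ∃ d, ∀ c, lcp u (v ++ [c]) = if c = d then v.length + 1 else v.length := by
  induction v generalizing u with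
  | nil =>
    cases u with
    | nil => simp at hu
    | cons a u => exact ⟨a, fun c => by simp [eq_comm]⟩
  | cons b v ih =>
    cases u with
    | nil => simp at hu
    | cons a u =>
      simp only [lcp_cons_cons, List.length_cons, List.cons_append] at h hu ⊢
      split_ifs at h with hab
      obtain ⟨d, hd⟩ := ih (u := u) (by omega) (by omega)
      refine ⟨d, fun c => ?_⟩
      simp only [if_pos hab, hd]
      split_ifs <;> rfl

theorem lcp_concat_of_length_le {u v : List β} (h : u.length ≤ v.length) (c : β) :
    lcp u (v ++ [c]) = lcp u v := by
  rcases (lcp_le_right u v).lt_or_eq with h' | h'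
  · exact lcp_concat_of_lt h' c
  · have h1 : v = (v ++ [c]).dropLast := by simp
    have h2 := lcp_dropLast u (v ++ [c])
    rw [← h1] at h2
    have h3 := lcp_le_left u (v ++ [c])
    simp at h2
    omega

end lcp

/-! ### Isometric embedding of binary words -/

section tree

variable {V β : Type*} {G : SimpleGraph V} {child : V → V → β → V}

/-- The walk never backtracks, and the vertex it came from is the only neighbour closer to `x`, so
each letter adds one to the distance. -/
theorem SimpleGraph.IsTree.dist_descend (hG : G.IsTree)
    (hadj : ∀ p v, G.Adj v p → ∀ c, G.Adj v (child p v c))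
    (hne : ∀ p v, G.Adj v p → ∀ c, child p v c ≠ p) {x : V} (w : List β) {p v : V}
    (hvp : G.Adj v p) (hx : G.dist x v = G.dist x p + 1) :
    G.dist x (descend child p v w) = G.dist x v + w.length := by
  induction w generalizing p v with
  | nil => simp [descend]
  | cons c w ih =>
    have h := hG.dist_eq_add_one_of_ne hvp (hadj p v hvp c) (hne p v hvp c).symm hx
    rw [descend, ih (hadj p v hvp c).symm h, h, List.length_cons]
    omega

theorem SimpleGraph.IsTree.dist_descend_self (hG : G.IsTree)
    (hadj : ∀ p v, G.Adj v p → ∀ c, G.Adj v (child p v c))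
    (hne : ∀ p v, G.Adj v p → ∀ c, child p v c ≠ p) (w : List β) {p v : V}
    (hvp : G.Adj v p) : G.dist v (descend child p v w) = w.length := by
  cases w with
  | nil => simp [descend]
  | cons c w =>
    have h1 : G.dist v (child p v c) = 1 := SimpleGraph.dist_eq_one_iff_adj.2 (hadj p v hvp c)
    rw [descend, hG.dist_descend hadj hne w (hadj p v hvp c).symm (by simp [h1]), h1,
      List.length_cons]
    omega

/-- Words embed isometrically, with respect to the word metric of the tree of words. -/
theorem SimpleGraph.IsTree.dist_descend_descend [DecidableEq β] (hG : G.IsTree)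
    (hadj : ∀ p v, G.Adj v p → ∀ c, G.Adj v (child p v c))
    (hne : ∀ p v, G.Adj v p → ∀ c, child p v c ≠ p)
    (hinj : ∀ p v, G.Adj v p → Function.Injective (child p v)) (u w : List β) {p v : V}
    (hvp : G.Adj v p) :
    G.dist (descend child p v u) (descend child p v w) + 2 * lcp u w = u.length + w.length := by
  induction u generalizing p v w with
  | nil => simpa [descend] using hG.dist_descend_self hadj hne w hvp
  | cons a u ih =>
    cases w with
    | nil =>
      rw [SimpleGraph.dist_comm]
      simpa [descend] using hG.dist_descend_self hadj hne (a :: u) hvp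
    | cons b w =>
      have ha := hadj p v hvp a
      have hb := hadj p v hvp b
      by_cases hab : a = b
      · subst hab
        have := ih w ha.symm
        simp only [lcp_cons_cons, if_true, List.length_cons, descend]
        omega
      · have h1 := hG.dist_descend_self hadj hne (a :: u) hvp
        have h2 := hG.dist_descend_self hadj hne u ha.symm
        rw [descend] at h1
        rw [SimpleGraph.dist_comm] at h1 h2
        -- Seen from the end of the first walk, the letter `a` leads closer from `v`, so the
        -- different letter `b` leads away.
        have h3 := hG.dist_eq_add_one_of_ne ha hb (fun h => hab (hinj p v hvp h))
          (by rw [h1, h2, List.length_cons])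
        simp only [descend, lcp_cons_cons, if_neg hab, List.length_cons]
        rw [hG.dist_descend hadj hne w hb.symm h3, h3, h1, List.length_cons]
        omega

/-- The words over a two-letter alphabet embed isometrically into every `3`-regular tree. -/
theorem SimpleGraph.IsTree.exists_isometric_words [G.LocallyFinite] (hG : G.IsTree)
    (h3 : G.IsRegularOfDegree 3) :
    ∃ g : List Bool → V, ∀ u w, G.dist (g u) (g w) + 2 * lcp u w = u.length + w.length := by
  classical
  have hex : ∀ p v : V, ∃ f : Bool → V, G.Adj v p →
      (∀ c, G.Adj v (f c)) ∧ (∀ c, f c ≠ p) ∧ Function.Injective f := by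
    intro p v
    by_cases hvp : G.Adj v p
    · have hp : p ∈ G.neighborFinset v := (G.mem_neighborFinset v p).2 hvp
      have hcard : ((G.neighborFinset v).erase p).card = 2 := by
        rw [Finset.card_erase_of_mem hp, G.card_neighborFinset_eq_degree, h3 v]
      obtain ⟨x, y, hxy, he⟩ := Finset.card_eq_two.1 hcard
      have hx : x ∈ (G.neighborFinset v).erase p := by simp [he]
      have hy : y ∈ (G.neighborFinset v).erase p := by simp [he]
      rw [Finset.mem_erase, SimpleGraph.mem_neighborFinset] at hx hy
      refine ⟨fun c => if c then x else y, fun _ => ⟨?_, ?_, ?_⟩⟩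
      · rintro (_ | _) <;> simp [hx, hy]
      · rintro (_ | _) <;> simp [hx, hy]
      · rintro (_ | _) (_ | _) <;> simp [hxy, hxy.symm]
    · exact ⟨fun _ => p, fun h => absurd h hvp⟩
  choose child hchild using hex
  obtain ⟨v⟩ := hG.connected.nonempty
  have hpos : 0 < (G.neighborFinset v).card := by
    rw [G.card_neighborFinset_eq_degree, h3 v]; norm_num
  -- Any neighbour serves as the parent of the root `v`; every vertex reached then has exactly two
  -- children.
  obtain ⟨p, hp⟩ := Finset.card_pos.1 hpos
  rw [SimpleGraph.mem_neighborFinset] at hp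
  exact ⟨descend child p v, fun u w => hG.dist_descend_descend (fun p v h => (hchild p v h).1)
    (fun p v h => (hchild p v h).2.1) (fun p v h => (hchild p v h).2.2) u w hp⟩

end tree

/-! ### Encoding large alphabets by binary blocks -/

/-- The code word of length `D` for the letter `c`. -/
def unaryCode {b : ℕ} (D : ℕ) (c : Fin b) : List Bool :=
  List.replicate c false ++ (true :: List.replicate (D - c - 1) false)

theorem length_unaryCode {b D : ℕ} (hD : b ≤ D) (c : Fin b) : (unaryCode D c).length = D := by
  have := c.2
  simp [unaryCode]
  omega

theorem lcp_replicate_false_append_le (n : ℕ) (u v : List Bool) (m : ℕ) (h : n < m) :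
    lcp (List.replicate n false ++ (true :: u)) (List.replicate m false ++ v) ≤ n := by
  induction n generalizing m with
  | zero =>
    obtain ⟨m, rfl⟩ : ∃ k, m = k + 1 := ⟨m - 1, by omega⟩
    simp [List.replicate_succ]
  | succ n ih =>
    obtain ⟨m, rfl⟩ : ∃ k, m = k + 1 := ⟨m - 1, by omega⟩
    have := ih m (by omega)
    simp only [List.replicate_succ, List.cons_append, lcp_cons_cons, if_true]
    omega

/-- The codes differ at the position of the earlier `true`, which is below `b` whatever `D` is;
hence the relative error b/D can be made small. -/
theorem lcp_unaryCode_append_le {b : ℕ} (D : ℕ) {c d : Fin b} (h : c ≠ d) (u v : List Bool) :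
    lcp (unaryCode D c ++ u) (unaryCode D d ++ v) ≤ b := by
  have hc := c.2
  have hd := d.2
  simp only [unaryCode, List.append_assoc, List.cons_append]
  rcases lt_or_gt_of_ne (fun h' => h (Fin.ext h') : (c : ℕ) ≠ d) with h | h
  · exact (lcp_replicate_false_append_le _ _ _ _ h).trans hc.le
  · rw [lcp_comm]
    exact (lcp_replicate_false_append_le _ _ _ _ h).trans hd.le

theorem length_flatMap_unaryCode {b D : ℕ} (hD : b ≤ D) (u : List (Fin b)) :
    (u.flatMap (unaryCode D)).length = D * u.length := by
  induction u with
  | nil => simp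
  | cons c u ih =>
    rw [List.flatMap_cons, List.length_append, ih, length_unaryCode hD, List.length_cons]; ring

theorem le_lcp_flatMap_unaryCode {b D : ℕ} (hD : b ≤ D) (u v : List (Fin b)) :
    D * lcp u v ≤ lcp (u.flatMap (unaryCode D)) (v.flatMap (unaryCode D)) := by
  induction u generalizing v with
  | nil => simp
  | cons c u ih =>
    cases v with
    | nil => simp
    | cons d v =>
      simp only [lcp_cons_cons, List.flatMap_cons]
      split_ifs with h
      · subst h
        rw [lcp_append_append, length_unaryCode hD]
        linarith [ih v]
      · simp

theorem lcp_flatMap_unaryCode_le {b D : ℕ} (hD : b ≤ D) (u v : List (Fin b)) :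
    lcp (u.flatMap (unaryCode D)) (v.flatMap (unaryCode D)) ≤ D * lcp u v + b := by
  induction u generalizing v with
  | nil => simp
  | cons c u ih =>
    cases v with
    | nil => simp
    | cons d v =>
      simp only [lcp_cons_cons, List.flatMap_cons]
      split_ifs with h
      · subst h
        rw [lcp_append_append, length_unaryCode hD]
        linarith [ih v]
      · simpa using lcp_unaryCode_append_le D h _ _

/-- The distance in the tree of words. -/
def wordDist {β : Type*} [DecidableEq β] (u v : List β) : ℕ := u.length + v.length - 2 * lcp u v

theorem wordDist_add {β : Type*} [DecidableEq β] (u v : List β) :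
    wordDist u v + 2 * lcp u v = u.length + v.length := by
  have := lcp_le_left u v
  have := lcp_le_right u v
  rw [wordDist]; omega

/-- Up to scaling, the tree of words over any finite alphabet embeds almost isometrically into
every `3`-regular tree. -/
theorem SimpleGraph.IsTree.exists_almost_isometric_words {V : Type*} {G : SimpleGraph V}
    [G.LocallyFinite] (hG : G.IsTree) (h3 : G.IsRegularOfDegree 3) {b D : ℕ} (hD : b ≤ D) :
    ∃ f : List (Fin b) → V, ∀ u v, G.dist (f u) (f v) ≤ D * wordDist u v ∧
      D * wordDist u v ≤ G.dist (f u) (f v) + 2 * b * wordDist u v := by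
  obtain ⟨g, hg⟩ := hG.exists_isometric_words h3
  refine ⟨fun u => g (u.flatMap (unaryCode D)), fun u v => ?_⟩
  have h1 := hg (u.flatMap (unaryCode D)) (v.flatMap (unaryCode D))
  have h2 := le_lcp_flatMap_unaryCode hD u v
  have h3 := lcp_flatMap_unaryCode_le hD u v
  have h4 := wordDist_add u v
  rw [length_flatMap_unaryCode hD, length_flatMap_unaryCode hD] at h1
  have h5 : D * wordDist u v + 2 * (D * lcp u v) = D * u.length + D * v.length := by
    linear_combination D * h4
  refine ⟨by linarith, ?_⟩
  -- The additive error 2b becomes multiplicative, since nonzero word distances are at least 1.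
  rcases Nat.eq_zero_or_pos (wordDist u v) with h0 | h0
  · simp [h0]
  · have : 2 * b ≤ 2 * b * wordDist u v := Nat.le_mul_of_pos_right _ h0
    linarith

/-! ### Two-time expectations of a reversible chain -/

section chain

variable {S : Type*} [Fintype S] [DecidableEq S]

/-- The expectation of `W (Z 0) (Z t)` for the Markov chain `Z` with initial law `π` and transition
matrix `a`. -/
def pairMean (π : S → ℝ) (a : Matrix S S ℝ) (t : ℕ) (W : S → S → ℝ) : ℝ :=
  ∑ i, ∑ j, π i * (a ^ t) i j * W i j

variable {π : S → ℝ} {a : Matrix S S ℝ}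

theorem pow_apply_nonneg (ha : a ∈ Matrix.rowStochastic ℝ S) (t : ℕ) (i j : S) :
    0 ≤ (a ^ t) i j := Matrix.nonneg_of_mem_rowStochastic (pow_mem ha t)

theorem pairMean_mono (hπ : ∀ i, 0 ≤ π i) (ha : a ∈ Matrix.rowStochastic ℝ S) {t : ℕ}
    {W W' : S → S → ℝ} (h : ∀ i j, (a ^ t) i j ≠ 0 → W i j ≤ W' i j) :
    pairMean π a t W ≤ pairMean π a t W' := by
  refine Finset.sum_le_sum fun i _ => Finset.sum_le_sum fun j _ => ?_
  by_cases h0 : (a ^ t) i j = 0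
  · simp [h0]
  · exact mul_le_mul_of_nonneg_left (h i j h0) (mul_nonneg (hπ i) (pow_apply_nonneg ha t i j))

theorem pairMean_add (t : ℕ) (W W' : S → S → ℝ) :
    pairMean π a t (fun i j => W i j + W' i j) = pairMean π a t W + pairMean π a t W' := by
  simp only [pairMean, mul_add, Finset.sum_add_distrib]

theorem pairMean_const_mul (t : ℕ) (c : ℝ) (W : S → S → ℝ) :
    pairMean π a t (fun i j => c * W i j) = c * pairMean π a t W := by
  simp only [pairMean, Finset.mul_sum]
  exact Finset.sum_congr rfl fun i _ => Finset.sum_congr rfl fun j _ => by ring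

theorem pairMean_zero (W : S → S → ℝ) : pairMean π a 0 W = ∑ i, π i * W i i := by
  simp [pairMean, Matrix.one_apply]

/-- Conditioning on the last step: a bound on the drift in the second variable can be summed over
time. -/
theorem pairMean_succ (t : ℕ) (W : S → S → ℝ) :
    pairMean π a (t + 1) W = pairMean π a t fun i j => ∑ k, a j k * W i k := by
  simp only [pairMean, pow_succ, Matrix.mul_apply, Finset.mul_sum, Finset.sum_mul]
  refine Finset.sum_congr rfl fun i _ => ?_
  rw [Finset.sum_comm]
  exact Finset.sum_congr rfl fun j _ => Finset.sum_congr rfl fun k _ => by ring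

theorem pow_reversible (hrev : ∀ i j, π i * a i j = π j * a j i) (t : ℕ) (i j : S) :
    π i * (a ^ t) i j = π j * (a ^ t) j i := by
  induction t generalizing i j with
  | zero =>
    by_cases h : i = j
    · rw [h]
    · simp [h, Ne.symm h]
  | succ t ih =>
    rw [pow_succ, Matrix.mul_apply, ← pow_succ, pow_succ', Matrix.mul_apply, Finset.mul_sum,
      Finset.mul_sum]
    refine Finset.sum_congr rfl fun k _ => ?_
    linear_combination a k j * ih i k + (a ^ t) k i * hrev k j

theorem pairMean_swap (hrev : ∀ i j, π i * a i j = π j * a j i) (t : ℕ) (W : S → S → ℝ) :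
    pairMean π a t (fun i j => W j i) = pairMean π a t W := by
  unfold pairMean
  rw [Finset.sum_comm]
  exact Finset.sum_congr rfl fun i _ => Finset.sum_congr rfl fun j _ => by
    rw [pow_reversible hrev]

theorem pairMean_right (ha : a ∈ Matrix.rowStochastic ℝ S)
    (hrev : ∀ i j, π i * a i j = π j * a j i) (t : ℕ) (g : S → ℝ) :
    pairMean π a t (fun _ j => g j) = ∑ i, π i * g i := by
  rw [← pairMean_swap hrev]
  refine Finset.sum_congr rfl fun i _ => ?_
  rw [← Finset.sum_mul, ← Finset.mul_sum, Matrix.sum_row_of_mem_rowStochastic (pow_mem ha t),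
    mul_one]

theorem pairMean_const (ha : a ∈ Matrix.rowStochastic ℝ S) (hπ : ∑ i, π i = 1)
    (hrev : ∀ i j, π i * a i j = π j * a j i) (t : ℕ) (c : ℝ) :
    pairMean π a t (fun _ _ => c) = c := by
  rw [pairMean_right ha hrev t fun _ => c, ← Finset.sum_mul, hπ, one_mul]

end chain

/-! ### The walk on words of bounded length -/

section words

variable {b : ℕ}

/-- Words of length at most `N`. -/
abbrev BoundedWord (b N : ℕ) : Type := {u : List (Fin b) // u.length ≤ N}

noncomputable instance (b N : ℕ) : Fintype (BoundedWord b N) :=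
  (List.finite_length_le (Fin b) N).fintype

variable {N : ℕ}

/-- Append a letter, if the maximal length is not yet reached. -/
def BoundedWord.up (u : BoundedWord b N) (c : Fin b) : BoundedWord b N :=
  if h : u.1.length < N then ⟨u.1 ++ [c], by simpa using h⟩ else u

/-- Drop the last letter, if there is one. -/
def BoundedWord.down (u : BoundedWord b N) : BoundedWord b N :=
  ⟨u.1.dropLast, by have := u.2; simp; omega⟩

/-- The random walk on words that appends a random letter or drops the last letter, with
probability one half each. -/
noncomputable def wordWalk (b N : ℕ) : Matrix (BoundedWord b N) (BoundedWord b N) ℝ := fun u v =>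
  (2 * b : ℝ)⁻¹ * ∑ c, ((if u.up c = v then 1 else 0) + if u.down = v then 1 else 0)

/-- The stationary distribution of `wordWalk`, which has a uniformly distributed length. -/
noncomputable def wordLaw (b N : ℕ) (u : BoundedWord b N) : ℝ :=
  ((b : ℝ) ^ u.1.length * (N + 1))⁻¹

theorem wordLaw_nonneg (u : BoundedWord b N) : 0 ≤ wordLaw b N u := by
  unfold wordLaw; positivity

theorem sum_wordWalk_mul (u : BoundedWord b N) (F : BoundedWord b N → ℝ) :
    ∑ v, wordWalk b N u v * F v = (2 * b : ℝ)⁻¹ * ∑ c, (F (u.up c) + F u.down) := by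
  simp only [wordWalk, mul_assoc, ← Finset.mul_sum, Finset.sum_mul]
  rw [Finset.sum_comm]
  simp [add_mul, Finset.sum_add_distrib]

theorem wordWalk_mem_rowStochastic (hb : 0 < b) :
    wordWalk b N ∈ Matrix.rowStochastic ℝ (BoundedWord b N) := by
  rw [Matrix.mem_rowStochastic_iff_sum]
  refine ⟨fun u v => ?_, fun u => ?_⟩
  · unfold wordWalk
    positivity
  · have := sum_wordWalk_mul u fun _ => 1
    simp only [mul_one] at this
    have hb' : (b : ℝ) ≠ 0 := by positivity
    rw [this]
    simp
    field_simp
    norm_num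

theorem eq_up_or_down_of_wordWalk_ne_zero {u v : BoundedWord b N} (h : wordWalk b N u v ≠ 0) :
    (∃ c, u.up c = v) ∨ u.down = v := by
  by_contra! h'
  exact h (by simp [wordWalk, h'.1, h'.2])

theorem BoundedWord.length_down (u : BoundedWord b N) : u.down.1.length = u.1.length - 1 := by
  simp [BoundedWord.down]

theorem BoundedWord.sum_up_eq {u v : BoundedWord b N} (huv : u ≠ v) :
    (∑ c, if u.up c = v then (1 : ℝ) else 0) = if v.down = u then 1 else 0 := by
  -- Since u ≠ v, the idle step at maximal length does not contribute.
  have hiff : ∀ c, u.up c = v ↔ u.1 ++ [c] = v.1 := by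
    intro c
    unfold BoundedWord.up
    split_ifs with h
    · exact Subtype.ext_iff
    · refine ⟨fun h' => absurd h' huv, fun h' => absurd v.2 ?_⟩
      rw [← h']
      simpa using h
  simp only [hiff]
  split_ifs with h
  · have hv : v.1 ≠ [] := by
      intro h0
      exact huv (by rw [← h]; apply Subtype.ext; simp [BoundedWord.down, h0])
    have hu : u.1 = v.1.dropLast := by rw [← h]; rfl
    have h1 : ∀ c, u.1 ++ [c] = v.1 ↔ v.1.getLast hv = c := by
      intro c
      conv_lhs => rw [hu, ← List.dropLast_append_getLast hv]
      simp [eq_comm]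
    simp [h1]
  · refine Finset.sum_eq_zero fun c _ => if_neg fun h' => h ?_
    apply Subtype.ext
    simp [BoundedWord.down, ← h']

/-- A given child has probability 1/(2b), the parent 1/2, and the law loses a factor `b` per letter.
-/
theorem wordWalk_reversible (hb : 0 < b) (u v : BoundedWord b N) :
    wordLaw b N u * wordWalk b N u v = wordLaw b N v * wordWalk b N v u := by
  rcases eq_or_ne u v with rfl | huv
  · rfl
  have hb' : (b : ℝ) ≠ 0 := by positivity
  have hlen : ∀ {u v : BoundedWord b N}, u ≠ v → v.down = u → v.1.length = u.1.length + 1 := by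
    intro u v huv h
    have h0 : v.1 ≠ [] := by
      intro h0
      exact huv (by rw [← h]; apply Subtype.ext; simp [BoundedWord.down, h0])
    have := List.length_pos_iff.2 h0
    rw [← h, v.length_down]
    omega
  simp only [wordWalk, Finset.sum_add_distrib, BoundedWord.sum_up_eq huv,
    BoundedWord.sum_up_eq huv.symm, Finset.sum_const, Finset.card_univ, Fintype.card_fin,
    nsmul_eq_mul, wordLaw]
  by_cases h1 : v.down = u
  · have l1 := hlen huv h1
    have h2 : u.down ≠ v := fun h2 => by have := hlen huv.symm h2; omega
    rw [if_pos h1, if_neg h2, l1, pow_succ]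
    field_simp
    simp
  · by_cases h2 : u.down = v
    · have l2 := hlen huv.symm h2
      rw [if_neg h1, if_pos h2, l2, pow_succ]
      field_simp
      simp
    · simp [h1, h2]

theorem card_filter_length_eq {h : ℕ} (hh : h ≤ N) :
    (Finset.univ.filter fun u : BoundedWord b N => u.1.length = h).card = b ^ h := by
  rw [← Fintype.card_subtype]
  let e : {u : BoundedWord b N // u.1.length = h} ≃ List.Vector (Fin b) h :=
    { toFun := fun u => ⟨u.1.1, u.2⟩
      invFun := fun u => ⟨⟨u.1, u.2.le.trans hh⟩, u.2⟩
      left_inv := fun _ => rfl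
      right_inv := fun _ => rfl }
  rw [Fintype.card_congr e, card_vector, Fintype.card_fin]

theorem sum_wordLaw_mul (hb : 0 < b) (g : ℕ → ℝ) :
    ∑ u, wordLaw b N u * g u.1.length = (∑ h ∈ Finset.range (N + 1), g h) / (N + 1) := by
  have hb' : (b : ℝ) ≠ 0 := by positivity
  rw [← Finset.sum_fiberwise_of_maps_to (t := Finset.range (N + 1))
    (g := fun u : BoundedWord b N => u.1.length)
    (fun u _ => Finset.mem_range.2 (Nat.lt_succ_of_le u.2)), Finset.sum_div]
  refine Finset.sum_congr rfl fun h hh => ?_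
  have hc := card_filter_length_eq (b := b) (Nat.lt_succ_iff.1 (Finset.mem_range.1 hh))
  rw [Finset.sum_congr rfl (g := fun _ => ((b : ℝ) ^ h * (N + 1))⁻¹ * g h), Finset.sum_const, hc,
    nsmul_eq_mul]
  · push_cast
    field_simp
  · intro u hu
    rw [wordLaw, (Finset.mem_filter.1 hu).2]

theorem sum_wordLaw (hb : 0 < b) : ∑ u, wordLaw b N u = 1 := by
  have := sum_wordLaw_mul (N := N) hb fun _ => 1
  simp only [mul_one] at this
  rw [this, Finset.sum_const, Finset.card_range, nsmul_eq_mul, mul_one]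
  push_cast
  exact div_self (by positivity)

/-- The number of ends of the range of lengths at which a word lies. -/
def boundaryCount (N h : ℕ) : ℝ := (if h = 0 then 1 else 0) + if h = N then 1 else 0

theorem sum_wordLaw_mul_boundaryCount (hb : 0 < b) :
    ∑ u, wordLaw b N u * boundaryCount N u.1.length = 2 / (N + 1) := by
  rw [sum_wordLaw_mul hb]
  simp [boundaryCount, Finset.sum_add_distrib]
  norm_num

end words

/-! ### Drift and the second moment of the distance -/

/-- A function of the lengths `p`, `q` of two words and of the length `m` of their longest common
prefix. In terms of `k = p - m` and `l = q - m` it is `3 (l - k) ^ 2 - 4 (k ^ 2 - k - 2 k l)`, whose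
drift along the walk of the second word is close to `3`. -/
def driftPoly (p q m : ℝ) : ℝ :=
  3 * (q - p) ^ 2 - 4 * ((p - m) ^ 2 - (p - m) - 2 * (p - m) * (q - m))

section words

variable {b : ℕ}

theorem lcp_le_lcp_concat (u v : List (Fin b)) (c : Fin b) : lcp u v ≤ lcp u (v ++ [c]) := by
  have h1 := lcp_dropLast u (v ++ [c])
  simp only [List.dropLast_concat] at h1
  omega

theorem wordDist_comm (u v : List (Fin b)) : wordDist u v = wordDist v u := by
  rw [wordDist, wordDist, lcp_comm, add_comm]

theorem wordDist_concat_le (u v : List (Fin b)) (c : Fin b) :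
    wordDist u (v ++ [c]) ≤ wordDist u v + 1 := by
  have h1 := wordDist_add u v
  have h2 := wordDist_add u (v ++ [c])
  have h3 := lcp_le_lcp_concat u v c
  simp at h2
  omega

theorem wordDist_dropLast_le (u v : List (Fin b)) :
    wordDist u v.dropLast ≤ wordDist u v + 1 := by
  have h1 := wordDist_add u v
  have h2 := wordDist_add u v.dropLast
  have h3 := lcp_dropLast u v
  have h4 := lcp_le_right u v
  simp at h2
  omega

/-- Only if `v` is a proper prefix of `u` does a letter lengthen the common prefix; there is then
exactly one, and it lowers the value by 8. -/
theorem sum_driftPoly_concat_ge (u v : List (Fin b)) :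
    b * driftPoly u.length (v.length + 1) (lcp u v) - 8 ≤
      ∑ c, driftPoly u.length (v.length + 1) (lcp u (v ++ [c])) := by
  by_cases h : lcp u v = v.length ∧ v.length < u.length
  · obtain ⟨d, hd⟩ := exists_lcp_concat_of_eq h.1 h.2
    have : ∀ c, driftPoly u.length (v.length + 1) (lcp u (v ++ [c])) =
        driftPoly u.length (v.length + 1) (lcp u v) + if c = d then -8 else 0 := by
      intro c
      rw [hd, h.1]
      split_ifs
      · push_cast
        unfold driftPoly
        ring
      · ring
    simp only [this, Finset.sum_add_distrib]
    simp
  · have : ∀ c, lcp u (v ++ [c]) = lcp u v := by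
      intro c
      rcases (lcp_le_right u v).lt_or_eq with h' | h'
      · exact lcp_concat_of_lt h' c
      · exact lcp_concat_of_length_le (by by_contra h2; exact h ⟨h', by omega⟩) c
    simp [this]

variable {N : ℕ}

/-- For l > 0 only 3(l - k)² has a second difference, as the correction is linear in l. For l = 0
dropping a letter moves the branch point, and k² - k - 2kl at (k + 1, 0) and (k, 1) averages to its
value at (k, 0). -/
theorem driftPoly_dropLast_add_concat (u : List (Fin b)) {v : List (Fin b)} (hv : v ≠ []) :
    driftPoly u.length v.length (lcp u v) * 2 + 6 =
      driftPoly u.length v.dropLast.length (lcp u v.dropLast) +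
        driftPoly u.length (v.length + 1) (lcp u v) := by
  have h1 := lcp_dropLast u v
  have h2 := lcp_le_right u v
  obtain ⟨q, hq⟩ : ∃ q, v.length = q + 1 :=
    ⟨v.length - 1, by have := List.length_pos_iff.2 hv; omega⟩
  rw [List.length_dropLast, h1, hq, Nat.add_sub_cancel]
  rcases (show lcp u v ≤ q ∨ lcp u v = q + 1 by omega) with h | h
  · rw [min_eq_left h]
    push_cast
    unfold driftPoly
    ring
  · rw [min_eq_right (by omega), h]
    push_cast
    unfold driftPoly
    ring

/-- The drift of `driftPoly` along the walk. -/
theorem drift_ge (hb : 0 < b) (u v : BoundedWord b N) :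
    driftPoly u.1.length v.1.length (lcp u.1 v.1) + (3 - 4 / b) -
        7 * ((wordDist u.1 v.1 + 1) * boundaryCount N v.1.length) ≤
      ∑ w, wordWalk b N v w * driftPoly u.1.length w.1.length (lcp u.1 w.1) := by
  rw [sum_wordWalk_mul, Finset.sum_add_distrib, Finset.sum_const, Finset.card_univ,
    Fintype.card_fin, nsmul_eq_mul]
  have hb' : (0 : ℝ) < b := by positivity
  have hX : (wordDist u.1 v.1 : ℝ) + 2 * lcp u.1 v.1 = u.1.length + v.1.length := by
    exact_mod_cast wordDist_add u.1 v.1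
  have hm1 : (lcp u.1 v.1 : ℝ) ≤ u.1.length := by exact_mod_cast lcp_le_left u.1 v.1
  have hm2 : (lcp u.1 v.1 : ℝ) ≤ v.1.length := by exact_mod_cast lcp_le_right u.1 v.1
  have hb4 : 0 < 4 / (b : ℝ) := by positivity
  have hup : v.1.length < N → b * driftPoly u.1.length (v.1.length + 1) (lcp u.1 v.1) - 8 ≤
      ∑ c, driftPoly u.1.length (v.up c).1.length (lcp u.1 (v.up c).1) := by
    intro h
    simpa [BoundedWord.up, h] using sum_driftPoly_concat_ge u.1 v.1
  have hup' : v.1.length = N →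
      ∑ c, driftPoly u.1.length (v.up c).1.length (lcp u.1 (v.up c).1) =
        b * driftPoly u.1.length v.1.length (lcp u.1 v.1) := by
    intro h
    simp [BoundedWord.up, h]
  have hdown : v.1 ≠ [] → driftPoly u.1.length v.1.length (lcp u.1 v.1) * 2 + 6 =
      driftPoly u.1.length v.down.1.length (lcp u.1 v.down.1) +
        driftPoly u.1.length (v.1.length + 1) (lcp u.1 v.1) := driftPoly_dropLast_add_concat u.1
  have hdown' : v.1 = [] → v.down = v := fun h => Subtype.ext (by simp [BoundedWord.down, h])
  set U := ∑ c, driftPoly u.1.length (v.up c).1.length (lcp u.1 (v.up c).1)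
  set B := driftPoly u.1.length v.down.1.length (lcp u.1 v.down.1) with hB
  -- Here `y` is the value at a child off the branch of `u`; the loss 8, weighted by 1/(2b), gives
  -- 4/b.
  have reduce : ∀ y : ℝ, (b : ℝ) * y - 8 ≤ U → (y + B) / 2 - 4 / b ≤
      (2 * b : ℝ)⁻¹ * (U + b * B) := by
    intro y hy
    have : (y + B) / 2 - 4 / b = (2 * b : ℝ)⁻¹ * (b * y - 8 + b * B) := by field_simp; ring
    rw [this]
    gcongr
  -- Away from the ends `hdown` gives the gain 3. At an end a step is idle, and the loss is linear
  -- in the distance; 7 is a crude constant.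
  rcases v.2.lt_or_eq with hN | hN
  · refine le_trans ?_ (reduce _ (hup hN))
    by_cases h0 : v.1 = []
    · have hl : v.1.length = 0 := by simp [h0]
      have hm : lcp u.1 v.1 = 0 := by simp [h0]
      rw [hdown' h0] at hB
      rw [hl, hm] at hX hB
      rw [hB, hl, hm, boundaryCount, if_pos rfl, if_neg (by omega)]
      unfold driftPoly
      push_cast at hX ⊢
      have : (0 : ℝ) ≤ u.1.length := by positivity
      linarith
    · have := hdown h0
      have hl : v.1.length ≠ 0 := by simpa using h0
      rw [boundaryCount, if_neg hl, if_neg hN.ne]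
      linarith
  · have := reduce _ (by rw [hup' hN]; linarith)
    refine le_trans ?_ this
    by_cases h0 : v.1 = []
    · have hl : v.1.length = 0 := by simp [h0]
      rw [hdown' h0] at hB
      rw [hB, boundaryCount, if_pos hl, if_pos hN]
      have : (0 : ℝ) ≤ wordDist u.1 v.1 := by positivity
      linarith
    · have := hdown h0
      have hl : v.1.length ≠ 0 := by simpa using h0
      rw [boundaryCount, if_neg hl, if_pos hN]
      unfold driftPoly at this ⊢
      linarith

theorem wordDist_le_of_wordWalk_ne_zero (u : BoundedWord b N) {v w : BoundedWord b N}
    (h : wordWalk b N v w ≠ 0) : wordDist u.1 w.1 ≤ wordDist u.1 v.1 + 1 := by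
  rcases eq_up_or_down_of_wordWalk_ne_zero h with ⟨c, rfl⟩ | rfl
  · unfold BoundedWord.up
    split_ifs
    · exact wordDist_concat_le _ _ _
    · omega
  · exact wordDist_dropLast_le _ _

theorem wordDist_self (u : List (Fin b)) : wordDist u u = 0 := by
  simp [wordDist]; omega

theorem wordDist_le_of_pow_ne_zero (t : ℕ) (u v : BoundedWord b N)
    (h : (wordWalk b N ^ t) u v ≠ 0) : wordDist u.1 v.1 ≤ t := by
  induction t generalizing v with
  | zero =>
    by_cases huv : u = v
    · simp [huv, wordDist_self]
    · simp [huv] at h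
  | succ t ih =>
    rw [pow_succ, Matrix.mul_apply] at h
    obtain ⟨k, _, hk⟩ := Finset.exists_ne_zero_of_sum_ne_zero h
    have h1 := ih k (left_ne_zero_of_mul hk)
    have h2 := wordDist_le_of_wordWalk_ne_zero u (right_ne_zero_of_mul hk)
    omega

/-- At time `t` the distance is at most `t` and the ends have total expected count 2/(N + 1), so the
step from `t` to t + 1 loses at most 14(t + 1)/(N + 1). -/
theorem pairMean_driftPoly_ge (hb : 0 < b) (t : ℕ) :
    t * (3 - 4 / b) - 14 * t ^ 2 / (N + 1) ≤ pairMean (wordLaw b N) (wordWalk b N) t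
      fun u v => driftPoly u.1.length v.1.length (lcp u.1 v.1) := by
  have hstoch := wordWalk_mem_rowStochastic (N := N) hb
  have hrev := wordWalk_reversible (N := N) hb
  induction t with
  | zero => simp [pairMean_zero, driftPoly]
  | succ t ih =>
    have hbd : ∀ h, 0 ≤ boundaryCount N h := fun h => by unfold boundaryCount; positivity
    have h1 : pairMean (wordLaw b N) (wordWalk b N) t
        (fun u v => (driftPoly u.1.length v.1.length (lcp u.1 v.1) + (3 - 4 / b)) +
          (-(7 * (t + 1))) * boundaryCount N v.1.length) ≤ _ :=
      pairMean_mono (W' := fun u v =>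
        ∑ w, wordWalk b N v w * driftPoly u.1.length w.1.length (lcp u.1 w.1))
        wordLaw_nonneg hstoch fun u v huv => by
          have hX : (wordDist u.1 v.1 : ℝ) ≤ t := by
            exact_mod_cast wordDist_le_of_pow_ne_zero t u v huv
          have := mul_le_mul_of_nonneg_right hX (hbd v.1.length)
          have := drift_ge hb u v
          linarith
    rw [pairMean_add, pairMean_add, pairMean_const hstoch (sum_wordLaw hb) hrev,
      pairMean_const_mul, pairMean_right hstoch hrev t fun v => boundaryCount N v.1.length,
      sum_wordLaw_mul_boundaryCount hb, ← pairMean_succ] at h1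
    have h2 : 14 * ((t : ℝ) + 1) ^ 2 / (N + 1) =
        14 * t ^ 2 / (N + 1) + 7 * (t + 1) * (2 / (N + 1)) + 14 * t / (N + 1) := by ring
    have h3 : 0 ≤ 14 * (t : ℝ) / (N + 1) := by positivity
    push_cast
    linarith

theorem pairMean_wordDist_sq_ge (hb : 0 < b) (t : ℕ) {n : ℝ} (hn : 0 < n) :
    t * (3 - 4 / b) - 14 * t ^ 2 / (N + 1) - 4 * n ≤
      (1 + 1 / n) * pairMean (wordLaw b N) (wordWalk b N) t
        fun u v => (wordDist u.1 v.1 : ℝ) ^ 2 := by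
  have hstoch := wordWalk_mem_rowStochastic (N := N) hb
  have hrev := wordWalk_reversible (N := N) hb
  have h1 := pairMean_driftPoly_ge (N := N) hb t
  let g : BoundedWord b N → BoundedWord b N → ℝ := fun u v => ((u.1.length : ℝ) - lcp u.1 v.1) ^ 2
  have h2 : pairMean (wordLaw b N) (wordWalk b N) t
      (fun u v => driftPoly u.1.length v.1.length (lcp u.1 v.1) + 2 * g u v) ≤
    pairMean (wordLaw b N) (wordWalk b N) t
      (fun u v => ((1 + 1 / n) * (wordDist u.1 v.1 : ℝ) ^ 2 + 2 * g v u) + 4 * n) := by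
    refine pairMean_mono wordLaw_nonneg hstoch fun u v _ => ?_
    have hX : (wordDist u.1 v.1 : ℝ) = u.1.length + v.1.length - 2 * lcp u.1 v.1 := by
      rw [eq_sub_iff_add_eq]
      exact_mod_cast wordDist_add u.1 v.1
    have hm2 : (lcp u.1 v.1 : ℝ) ≤ v.1.length := by exact_mod_cast lcp_le_right u.1 v.1
    -- The term 4k is at most four times the distance, which AM-GM absorbs into a small multiple of
    -- its square.
    have h3 : 4 * (wordDist u.1 v.1 : ℝ) ≤ 1 / n * (wordDist u.1 v.1 : ℝ) ^ 2 + 4 * n := by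
      have : 1 / n * (wordDist u.1 v.1 : ℝ) ^ 2 + 4 * n - 4 * (wordDist u.1 v.1 : ℝ) =
          1 / n * ((wordDist u.1 v.1 : ℝ) - 2 * n) ^ 2 := by field_simp; ring
      have : 0 ≤ 1 / n * ((wordDist u.1 v.1 : ℝ) - 2 * n) ^ 2 := by positivity
      linarith
    have h4 : driftPoly u.1.length v.1.length (lcp u.1 v.1) + 2 * g u v =
        (wordDist u.1 v.1 : ℝ) ^ 2 + 2 * g v u + 4 * (u.1.length - lcp u.1 v.1) := by
      simp only [driftPoly, g, hX, lcp_comm v.1 u.1]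
      ring
    have h5 : 4 * ((u.1.length : ℝ) - lcp u.1 v.1) ≤ 4 * (wordDist u.1 v.1 : ℝ) := by
      rw [hX]; linarith
    rw [h4]
    linarith
  rw [pairMean_add, pairMean_add, pairMean_add, pairMean_const_mul, pairMean_const_mul,
    pairMean_const_mul, pairMean_const hstoch (sum_wordLaw hb) hrev, pairMean_swap hrev t g] at h2
  linarith

end words

/-! ### Transfer to the 3-regular tree and the limit -/

section main

variable {V : Type*} {G : SimpleGraph V}

/-- A Markov type inequality for a `3`-regular tree passes to the word walks. -/
theorem SimpleGraph.IsTree.pairMean_wordDist_sq_le [G.LocallyFinite] (hG : G.IsTree)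
    (h3 : G.IsRegularOfDegree 3) {K : ℝ}
    (hK : @MarkovTypeInequality V (graphMetricSpace G hG.connected) 2 K) {b : ℕ} (hb : 0 < b)
    (N t : ℕ) {D : ℕ} (hD : 2 * b ≤ D) :
    ((D : ℝ) - 2 * b) ^ 2 * pairMean (wordLaw b N) (wordWalk b N) t
      (fun u v => (wordDist u.1 v.1 : ℝ) ^ 2) ≤ K ^ 2 * t * (D : ℝ) ^ 2 := by
  have hstoch := wordWalk_mem_rowStochastic (N := N) hb
  have hrev := wordWalk_reversible (N := N) hb
  obtain ⟨f, hf⟩ := hG.exists_almost_isometric_words h3 (b := b) (D := D) (by omega)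
  let _ := graphMetricSpace G hG.connected
  have hdist : ∀ x y : V, Dist.dist x y = (G.dist x y : ℝ) := fun _ _ => rfl
  have h := hK.sum_le wordLaw_nonneg (sum_wordLaw hb) hstoch hrev (fun u => f u.1) t
  simp only [Real.rpow_two, hdist] at h
  have hD' : (2 * b : ℝ) ≤ D := by exact_mod_cast hD
  rw [← pairMean_const_mul]
  calc _ ≤ pairMean (wordLaw b N) (wordWalk b N) t
        (fun u v => (G.dist (f v.1) (f u.1) : ℝ) ^ 2) := by
        refine pairMean_mono wordLaw_nonneg hstoch fun u v _ => ?_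
        have h1 : (D : ℝ) * wordDist v.1 u.1 ≤
            G.dist (f v.1) (f u.1) + 2 * b * wordDist v.1 u.1 := by
          exact_mod_cast (hf v.1 u.1).2
        rw [wordDist_comm u.1 v.1, ← mul_pow]
        refine pow_le_pow_left₀ (mul_nonneg (by linarith) (by positivity)) ?_ 2
        linarith
    _ ≤ _ := h
    _ ≤ K ^ 2 * t * pairMean (wordLaw b N) (wordWalk b N) 1 (fun _ _ => (D : ℝ) ^ 2) := by
        refine mul_le_mul_of_nonneg_left ?_ (by positivity)
        refine le_trans (le_of_eq ?_) (pairMean_mono (W := fun u v =>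
          (G.dist (f v.1) (f u.1) : ℝ) ^ 2) wordLaw_nonneg hstoch fun u v huv => ?_)
        · simp only [pairMean, pow_one]
        · have h1 : (G.dist (f v.1) (f u.1) : ℝ) ≤ D * wordDist v.1 u.1 := by
            exact_mod_cast (hf v.1 u.1).1
          have h2 : (wordDist v.1 u.1 : ℝ) ≤ 1 := by
            rw [wordDist_comm]
            exact_mod_cast wordDist_le_of_pow_ne_zero 1 u v huv
          refine pow_le_pow_left₀ (by positivity) (h1.trans ?_) 2
          exact mul_le_of_le_one_right (by positivity) h2
    _ = _ := by rw [pairMean_const hstoch (sum_wordLaw hb) hrev]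

theorem SimpleGraph.IsTree.three_le_sq_of_markovTypeInequality [G.LocallyFinite] (hG : G.IsTree)
    (h3 : G.IsRegularOfDegree 3) {K : ℝ}
    (hK : @MarkovTypeInequality V (graphMetricSpace G hG.connected) 2 K) : 3 ≤ K ^ 2 := by
  have key : ∀ n : ℕ, 0 < n →
      (1 - 1 / (n : ℝ)) ^ 2 * (3 - 22 * (1 / (n : ℝ))) ≤ (1 + 1 / (n : ℝ)) * K ^ 2 := by
    intro n hn
    have hn' : (0 : ℝ) < n := by exact_mod_cast hn
    -- With b = n, t = n² and N = n³ the errors are 4n, 14n and 4n, in total 22n against the main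
    -- term 3n². The block length D = 2n² makes the embedding error 2b/D equal to 1/n.
    have h1 := pairMean_wordDist_sq_ge (N := n ^ 3) hn (n ^ 2) hn'
    have h2 := hG.pairMean_wordDist_sq_le h3 hK hn (n ^ 3) (n ^ 2) (D := 2 * n * n)
      (Nat.le_mul_of_pos_right _ hn)
    set E := pairMean (wordLaw n (n ^ 3)) (wordWalk n (n ^ 3)) (n ^ 2)
      fun u v => (wordDist u.1 v.1 : ℝ) ^ 2
    push_cast at h1 h2
    have h4 : 14 * ((n : ℝ) ^ 2) ^ 2 / (n ^ 3 + 1) ≤ 14 * n := by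
      rw [div_le_iff₀ (by positivity)]
      nlinarith
    have h5 : (n : ℝ) ^ 2 * (3 - 4 / n) = 3 * n ^ 2 - 4 * n := by field_simp
    have h6 : (n : ℝ) ^ 2 * (3 - 22 * (1 / n)) ≤ (1 + 1 / n) * E := by
      have : (n : ℝ) ^ 2 * (3 - 22 * (1 / n)) = 3 * n ^ 2 - 22 * n := by field_simp
      linarith
    have h7 : (1 - 1 / (n : ℝ)) ^ 2 * E ≤ K ^ 2 * n ^ 2 := by
      have e1 : (2 * (n : ℝ) * n - 2 * n) ^ 2 * E =
          (4 * n ^ 4) * ((1 - 1 / (n : ℝ)) ^ 2 * E) := by field_simp; ring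
      have e2 : K ^ 2 * (n : ℝ) ^ 2 * (2 * n * n) ^ 2 = (4 * n ^ 4) * (K ^ 2 * n ^ 2) := by ring
      rw [e1, e2] at h2
      exact le_of_mul_le_mul_left h2 (by positivity)
    refine le_of_mul_le_mul_left (a := (n : ℝ) ^ 2) ?_ (by positivity)
    calc _ = (1 - 1 / (n : ℝ)) ^ 2 * ((n : ℝ) ^ 2 * (3 - 22 * (1 / n))) := by ring
      _ ≤ (1 - 1 / (n : ℝ)) ^ 2 * ((1 + 1 / n) * E) := by gcongr
      _ = (1 + 1 / n) * ((1 - 1 / (n : ℝ)) ^ 2 * E) := by ring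
      _ ≤ (1 + 1 / n) * (K ^ 2 * n ^ 2) := by gcongr
      _ = _ := by ring
  have hl := tendsto_one_div_atTop_nhds_zero_nat (𝕜 := ℝ)
  have hL := ((hl.const_sub 1).pow 2).mul ((hl.const_mul 22).const_sub 3)
  have hR := (hl.const_add 1).mul_const (K ^ 2)
  have := le_of_tendsto_of_tendsto hL hR ((Filter.eventually_gt_atTop 0).mono key)
  simpa using this

end main

theorem mainTheorem12 {V : Type*} (G : SimpleGraph V) [G.LocallyFinite]
    (hG : G.IsTree) (h3 : G.IsRegularOfDegree 3) :
    ENNReal.ofReal (Real.sqrt 3) ≤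
      @markovTypeConstant V (graphMetricSpace G hG.connected) 2 := by
  refine le_iInf fun K => le_iInf fun hK => le_iInf fun hM => ENNReal.ofReal_le_ofReal ?_
  exact (Real.sqrt_le_left hK.le).2 (hG.three_le_sq_of_markovTypeInequality h3 hM)
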